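/- Let $X$ be a complex Banach space and $B(X)$ the algebra of bounded linear operators on $X$. Let $\mathcal S\subseteq B(X)$ be an operator band, that is, a non-empty multiplicative semigroup of operators with $S^2=S$ for every $S\in\mathcal S$, and suppose $\mathcal S\neq\{0\}$. Let $\mathcal A(\mathcal S)$ be the (not necessarily unital) subalgebra of $B(X)$ generated by $\mathcal S$, let $\mathcal S'=\{T\in B(X) : TS=ST \text{ for all } S\in\mathcal S\}$ be the commutant of $\mathcal S$, and let the hyperalgebra $\mathcal H(\mathcal S)$ be the subalgebra of $B(X)$ generated by $\mathcal S\cup\mathcal S'$. If $\mathcal N$ is a non-empty set of nilpotent operators contained in $\mathcal A(\mathcal S)$, then the two-sided ideal of $\mathcal H(\mathcal S)$ generated by $\mathcal N$ is a nil-ideal, that is, each of its elements is nilpotent. -/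

import Mathlib

namespace OperatorBand

variable {X : Type*} [NormedAddCommGroup X] [NormedSpace ℂ X]

/-- An operator band on `X`: a non-empty multiplicative semigroup of bounded linear operators,
all of which are idempotent. -/
structure IsOperatorBand (S : Set (X →L[ℂ] X)) : Prop where
  nonempty : S.Nonempty
  mul_mem : ∀ ⦃A B : X →L[ℂ] X⦄, A ∈ S → B ∈ S → A * B ∈ S
  idempotent : ∀ ⦃A : X →L[ℂ] X⦄, A ∈ S → A * A = A

/-- The commutant `S'` of a set of operators. -/
def commutant (S : Set (X →L[ℂ] X)) : Set (X →L[ℂ] X) :=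
  {T | ∀ A ∈ S, T * A = A * T}

/-- The (not necessarily unital) subalgebra `A(S)` of `B(X)` generated by `S`.
When `S` is an operator band this is its band algebra. -/
def generatedAlgebra (S : Set (X →L[ℂ] X)) : NonUnitalSubalgebra ℂ (X →L[ℂ] X) :=
  NonUnitalAlgebra.adjoin ℂ S

/-- The set of all nilpotent operators in `A(S)`. -/
def nilpotents (S : Set (X →L[ℂ] X)) : Set (X →L[ℂ] X) :=
  {T | T ∈ generatedAlgebra S ∧ IsNilpotent T}

/-- The hyperalgebra `H(S)`: the subalgebra of `B(X)` generated by `S` and its commutant.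
It contains the identity operator because the commutant does, so generating it as a unital
algebra or as a not necessarily unital one makes no difference; see `coe_hyperalgebra`. -/
def hyperalgebra (S : Set (X →L[ℂ] X)) : Subalgebra ℂ (X →L[ℂ] X) :=
  Algebra.adjoin ℂ (S ∪ commutant S)

theorem coe_hyperalgebra (S : Set (X →L[ℂ] X)) :
    (hyperalgebra S : Set (X →L[ℂ] X)) =
      (NonUnitalAlgebra.adjoin ℂ (S ∪ commutant S) : Set (X →L[ℂ] X)) := by
  have h1 : (1 : X →L[ℂ] X) ∈ NonUnitalAlgebra.adjoin ℂ (S ∪ commutant S) :=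
    NonUnitalAlgebra.subset_adjoin ℂ (Or.inr fun A _ => by simp)
  ext T
  constructor
  · intro hT
    induction hT using Algebra.adjoin_induction with
    | mem x hx => exact NonUnitalAlgebra.subset_adjoin ℂ hx
    | algebraMap r =>
      rw [Algebra.algebraMap_eq_smul_one]
      exact SMulMemClass.smul_mem r h1
    | add x y _ _ hx hy => exact add_mem hx hy
    | mul x y _ _ hx hy => exact mul_mem hx hy
  · intro hT
    have h : NonUnitalAlgebra.adjoin ℂ (S ∪ commutant S) ≤
        (hyperalgebra S).toNonUnitalSubalgebra :=
      NonUnitalAlgebra.adjoin_le Algebra.subset_adjoin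
    exact h hT

theorem generatedAlgebra_subset_hyperalgebra (S : Set (X →L[ℂ] X)) :
    (generatedAlgebra S : Set (X →L[ℂ] X)) ⊆ (hyperalgebra S : Set (X →L[ℂ] X)) := by
  rw [coe_hyperalgebra]
  exact NonUnitalAlgebra.adjoin_mono Set.subset_union_left

/-- The two-sided ideal of the hyperalgebra `H(S)` generated by the operators in `N`
(used for `N ⊆ H(S)`). As `H(S)` is a unital complex algebra, its two-sided ring ideals are
automatically linear subspaces. -/
def hyperIdeal (S N : Set (X →L[ℂ] X)) : TwoSidedIdeal (hyperalgebra S) :=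
  TwoSidedIdeal.span {T : hyperalgebra S | (T : X →L[ℂ] X) ∈ N}

/-- A two-sided ideal is a nil-ideal if each of its elements is nilpotent. -/
def IsNilIdeal {R : Type*} [Ring R] (J : TwoSidedIdeal R) : Prop :=
  ∀ T ∈ J, IsNilpotent T

end OperatorBand

/-!
The proof is purely algebraic. Adjoin the identity to the band `S`, obtaining a monoid `B` of
idempotents with the same commutant. Writing `a ≼ b` for `a * b * a = a` gives a quasi-order on
`B` whose equivalence classes are rectangular: if `u` and `w` are equivalent and `u ≼ c`, then
`u * c * w = u * w` (`mul_mul_eq_mul_of_bandLE`).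

Let `M` be the span of the elements `(p - q) * t`, with `p` and `q` equivalent in `B` and `t` in
the commutant. It is an ideal of the hyperalgebra, and the theorem follows from two facts.

* Every element of `M` is nilpotent. It involves only finitely many differences `p - q`, and since
  the commutant passes through them, its powers are combinations of long products of these.
  Such a product is zero (`exists_diffProd_eq_zero`): write it as `U * (p - q) * W` with `U` and
  `W` long. If one of the available differences is absent from `U` or from `W`, that block is zero
  by induction on their number. Otherwise the words in the expansions of `U` and `W` all lie in a
  single class, which is below `p` and `q`, and rectangularity makes `u * p * w` and `u * q * w`
  equal for any such words `u` and `w`.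
* The nilpotent elements of the band algebra lie in `M`. Since `a * b` and `b * a` are
  equivalent, `B` becomes commutative modulo `M`, and a nilpotent linear combination of
  commuting idempotents is zero (`eq_zero_of_isNilpotent_of_mem_span`).
-/

namespace OperatorBand

/-! ### The semilattice quasi-order of a band -/

/-- The quasi-order of a band with `a` below `b` iff `a * b * a = a`. The induced equivalence
relation is Green's relation `𝒟` of the band, and the quotient by it is a semilattice. -/
def BandLE {M : Type*} [Mul M] (a b : M) : Prop := a * b * a = a

section Monoid

variable {M : Type*} [Monoid M] {B : Submonoid M} {a b c u w : M}

theorem BandLE.of_mul_left (hB : ∀ b ∈ B, b * b = b) (ha : a ∈ B) (hb : b ∈ B)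
    (h : BandLE a (b * c)) : BandLE a b := by
  unfold BandLE at *
  calc a * b * a = a * b * (a * (b * c) * a) := by rw [h]
    _ = (a * b) * (a * b) * c * a := by simp only [mul_assoc]
    _ = a := by rw [hB _ (mul_mem ha hb)]; simpa only [mul_assoc] using h

theorem BandLE.of_mul_right (hB : ∀ b ∈ B, b * b = b) (ha : a ∈ B) (hc : c ∈ B)
    (h : BandLE a (b * c)) : BandLE a c := by
  unfold BandLE at *
  calc a * c * a = a * (b * c) * a * c * a := by rw [h]
    _ = a * b * ((c * a) * (c * a)) := by simp only [mul_assoc]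
    _ = a := by rw [hB _ (mul_mem hc ha)]; simpa only [mul_assoc] using h

theorem BandLE.mul (hB : ∀ b ∈ B, b * b = b) (ha : a ∈ B) (hb : b ∈ B) (hc : c ∈ B)
    (h : BandLE a b) (h' : BandLE a c) : BandLE a (b * c) := by
  unfold BandLE at *
  symm
  -- The word `c * a * b` is doubled, and the outer copies of `a` absorb the surplus letters.
  calc a = (a * c * a) * b * a := by rw [h', h]
    _ = a * (c * a * b) * a := by simp only [mul_assoc]
    _ = a * ((c * a * b) * (c * a * b)) * a := by rw [hB _ (mul_mem (mul_mem hc ha) hb)]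
    _ = (a * c * a) * b * c * (a * b * a) := by simp only [mul_assoc]
    _ = a * (b * c) * a := by rw [h, h']; simp only [mul_assoc]

theorem BandLE.refl (hB : ∀ b ∈ B, b * b = b) (ha : a ∈ B) : BandLE a a := by
  simp [BandLE, hB a ha]

theorem BandLE.trans (hB : ∀ b ∈ B, b * b = b) (ha : a ∈ B) (hb : b ∈ B) (hc : c ∈ B)
    (h : BandLE a b) (h' : BandLE b c) : BandLE a c := by
  have h1 : BandLE a (b * c * b) := by rw [h']; exact h
  exact (h1.of_mul_left hB ha (mul_mem hb hc)).of_mul_right hB ha hc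

theorem bandLE_mul_left (hB : ∀ b ∈ B, b * b = b) (ha : a ∈ B) (hb : b ∈ B) :
    BandLE (a * b) a :=
  (BandLE.refl hB (mul_mem ha hb)).of_mul_left hB (mul_mem ha hb) ha

theorem bandLE_mul_right (hB : ∀ b ∈ B, b * b = b) (ha : a ∈ B) (hb : b ∈ B) :
    BandLE (a * b) b :=
  (BandLE.refl hB (mul_mem ha hb)).of_mul_right hB (mul_mem ha hb) hb

/-- Rectangularity: between two `𝒟`-equivalent elements, every factor above them can be
deleted. -/
theorem mul_mul_eq_mul_of_bandLE (hB : ∀ b ∈ B, b * b = b) (hu : u ∈ B) (hw : w ∈ B)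
    (hc : c ∈ B) (huw : BandLE u w) (hwu : BandLE w u) (huc : BandLE u c) :
    u * c * w = u * w := by
  have h : u * (c * w) * u = u := huc.mul hB hu hc hw huw
  calc u * c * w = u * c * (w * u * w) := by rw [hwu]
    _ = u * (c * w) * u * w := by simp only [mul_assoc]
    _ = u * w := by rw [h]

/-- The pairs of `𝒟`-equivalent elements of the band `B`. -/
def equivPairs (B : Submonoid M) : Set (M × M) :=
  {z | z.1 ∈ B ∧ z.2 ∈ B ∧ BandLE z.1 z.2 ∧ BandLE z.2 z.1}

theorem mul_left_mem_equivPairs (hB : ∀ b ∈ B, b * b = b) {z : M × M} (hz : z ∈ equivPairs B)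
    (hb : b ∈ B) : (b * z.1, b * z.2) ∈ equivPairs B := by
  obtain ⟨h1, h2, h3, h4⟩ := hz
  have m1 := mul_mem hb h1
  have m2 := mul_mem hb h2
  exact ⟨m1, m2,
    (bandLE_mul_left hB hb h1).mul hB m1 hb h2
      ((bandLE_mul_right hB hb h1).trans hB m1 h1 h2 h3),
    (bandLE_mul_left hB hb h2).mul hB m2 hb h1
      ((bandLE_mul_right hB hb h2).trans hB m2 h2 h1 h4)⟩

theorem mul_right_mem_equivPairs (hB : ∀ b ∈ B, b * b = b) {z : M × M} (hz : z ∈ equivPairs B)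
    (hb : b ∈ B) : (z.1 * b, z.2 * b) ∈ equivPairs B := by
  obtain ⟨h1, h2, h3, h4⟩ := hz
  have m1 := mul_mem h1 hb
  have m2 := mul_mem h2 hb
  exact ⟨m1, m2,
    ((bandLE_mul_left hB h1 hb).trans hB m1 h1 h2 h3).mul hB m1 h2 hb
      (bandLE_mul_right hB h1 hb),
    ((bandLE_mul_left hB h2 hb).trans hB m2 h2 h1 h4).mul hB m2 h1 hb
      (bandLE_mul_right hB h2 hb)⟩

theorem mul_comm_mem_equivPairs (hB : ∀ b ∈ B, b * b = b) (ha : a ∈ B) (hb : b ∈ B) :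
    (a * b, b * a) ∈ equivPairs B := by
  have m1 := mul_mem ha hb
  have m2 := mul_mem hb ha
  exact ⟨m1, m2,
    (bandLE_mul_right hB ha hb).mul hB m1 hb ha (bandLE_mul_left hB ha hb),
    (bandLE_mul_right hB hb ha).mul hB m2 ha hb (bandLE_mul_left hB hb ha)⟩

/-- `u` is a meet, in the quasi-order `BandLE` of `B`, of the classes represented by the
pairs in `F`. Such a meet is determined up to `𝒟`-equivalence only. -/
def IsMeet (B : Submonoid M) (F : Set (M × M)) (u : M) : Prop :=
  u ∈ B ∧ (∀ z ∈ F, BandLE u z.1) ∧ ∀ v ∈ B, (∀ z ∈ F, BandLE v z.1) → BandLE v u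

end Monoid

/-! ### Products of differences of equivalent elements -/

section Ring

variable {R : Type*} [Ring R] {B : Submonoid R}

/-- The product of the differences `p - q` over a list of pairs `(p, q)`. -/
def diffProd (L : List (R × R)) : R := (L.map fun z => z.1 - z.2).prod

theorem diffProd_append (L L' : List (R × R)) :
    diffProd (L ++ L') = diffProd L * diffProd L' := by
  simp [diffProd]

/-- When the product is expanded, the words obtained all lie in a single `𝒟`-class. -/
theorem diffProd_mem_closure_isMeet (hB : ∀ b ∈ B, b * b = b) (L : List (R × R))
    (hL : ∀ z ∈ L, z ∈ equivPairs B) :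
    diffProd L ∈ AddSubgroup.closure {u | IsMeet B {z | z ∈ L} u} := by
  induction L with
  | nil =>
    refine AddSubgroup.subset_closure ⟨by simp [diffProd], by simp, fun v hv _ => ?_⟩
    simp [BandLE, diffProd, hB v hv]
  | cons z L ih =>
    obtain ⟨h1, h2, h3, h4⟩ := hL z (by simp)
    have hcons : diffProd (z :: L) = (z.1 - z.2) * diffProd L := by simp [diffProd]
    rw [hcons]
    -- `p` may be either entry of the pair `z`
    have key : ∀ p ∈ B, BandLE p z.1 → BandLE z.1 p → ∀ u, IsMeet B {z | z ∈ L} u →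
        IsMeet B {y | y ∈ z :: L} (p * u) := by
      rintro p hp hpz hzp u ⟨hu, hu1, hu2⟩
      have hpu := mul_mem hp hu
      refine ⟨hpu, fun y hy => ?_, fun v hv hvy => ?_⟩
      · rcases List.mem_cons.1 hy with rfl | hy
        · exact (bandLE_mul_left hB hp hu).trans hB hpu hp h1 hpz
        · exact (bandLE_mul_right hB hp hu).trans hB hpu hu
            (hL y (List.mem_cons_of_mem _ hy)).1 (hu1 y hy)
      · exact ((hvy z (by simp)).trans hB hv h1 hp hzp).mul hB hv hp hu
          (hu2 v hv fun y hy => hvy y (List.mem_cons_of_mem _ hy))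
    have ih' := ih fun y hy => hL y (List.mem_cons_of_mem _ hy)
    generalize diffProd L = P at ih'
    induction ih' using AddSubgroup.closure_induction with
    | mem u hu =>
      rw [sub_mul]
      exact sub_mem
        (AddSubgroup.subset_closure (key _ h1 (BandLE.refl hB h1) (BandLE.refl hB h1) u hu))
        (AddSubgroup.subset_closure (key _ h2 h4 h3 u hu))
    | zero => simp
    | add x y _ _ hx hy => rw [mul_add]; exact add_mem hx hy
    | neg x _ hx => rw [mul_neg]; exact neg_mem hx

theorem mul_sub_mul_eq_zero (hB : ∀ b ∈ B, b * b = b) {F : Set (R × R)}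
    (hF : F ⊆ equivPairs B) {z : R × R} (hz : z ∈ F) {x y : R}
    (hx : x ∈ AddSubgroup.closure {u | IsMeet B F u})
    (hy : y ∈ AddSubgroup.closure {u | IsMeet B F u}) :
    x * (z.1 - z.2) * y = 0 := by
  obtain ⟨h1, h2, h3, h4⟩ := hF hz
  induction hx using AddSubgroup.closure_induction with
  | mem u hu =>
    induction hy using AddSubgroup.closure_induction with
    | mem w hw =>
      obtain ⟨hu0, hu1, hu2⟩ := hu
      obtain ⟨hw0, hw1, hw2⟩ := hw
      have huw := hw2 u hu0 hu1
      have hwu := hu2 w hw0 hw1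
      rw [mul_sub, sub_mul, mul_mul_eq_mul_of_bandLE hB hu0 hw0 h1 huw hwu (hu1 z hz),
        mul_mul_eq_mul_of_bandLE hB hu0 hw0 h2 huw hwu
          ((hu1 z hz).trans hB hu0 h1 h2 h3), sub_self]
    | zero => simp
    | add a b _ _ ha hb => rw [mul_add, ha, hb, add_zero]
    | neg a _ ha => rw [mul_neg, ha, neg_zero]
  | zero => simp
  | add a b _ _ ha hb => rw [add_mul, add_mul, ha, hb, add_zero]
  | neg a _ ha => rw [neg_mul, neg_mul, ha, neg_zero]

/-- Products of differences of equivalent elements, taken from a finite set of pairs, vanish as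
soon as they are long enough. The bound depends on the number of pairs only. -/
theorem exists_diffProd_eq_zero (hB : ∀ b ∈ B, b * b = b) (k : ℕ) :
    ∃ n : ℕ, ∀ F : Finset (R × R), F.card ≤ k → (F : Set (R × R)) ⊆ equivPairs B →
      ∀ L : List (R × R), (∀ z ∈ L, z ∈ F) → n ≤ L.length → diffProd L = 0 := by
  classical
  induction k with
  | zero =>
    refine ⟨1, fun F hF _ L hL hn => ?_⟩
    obtain ⟨z, hz⟩ := List.exists_mem_of_length_pos hn
    have := hL z hz
    simp_all
  | succ k ih =>
    obtain ⟨n, hn⟩ := ih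
    refine ⟨n + 1 + n, fun F hF hFB L hL hlen => ?_⟩
    -- A block of length at least `n` either vanishes, a pair of `F` being absent from it, or
    -- it expands into representatives of the meet of all of `F`.
    have block : ∀ U : List (R × R), (∀ z ∈ U, z ∈ F) → n ≤ U.length →
        diffProd U = 0 ∨ diffProd U ∈ AddSubgroup.closure {u | IsMeet B (F : Set (R × R)) u} := by
      intro U hU hUn
      by_cases hall : ∀ z ∈ F, z ∈ U
      · right
        have h := diffProd_mem_closure_isMeet hB U fun z hz => hFB (hU z hz)
        have hset : {z | z ∈ U} = (F : Set (R × R)) := by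
          ext z; exact ⟨hU z, hall z⟩
        rwa [hset] at h
      · left
        push Not at hall
        obtain ⟨f, hf, hfU⟩ := hall
        refine hn (F.erase f) ?_ ?_ U ?_ hUn
        · rw [Finset.card_erase_of_mem hf]; omega
        · exact fun z hz => hFB (Finset.mem_of_mem_erase hz)
        · exact fun z hz => Finset.mem_erase.2 ⟨fun h => hfU (h ▸ hz), hU z hz⟩
    have hlt : n < L.length := by omega
    have hsplit : L = L.take n ++ ([L[n]] ++ L.drop (n + 1)) := by simp
    have hmul : diffProd L =
        diffProd (L.take n) * (L[n].1 - L[n].2) * diffProd (L.drop (n + 1)) := by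
      conv_lhs => rw [hsplit]
      rw [diffProd_append, diffProd_append, mul_assoc]
      simp [diffProd]
    rw [hmul]
    rcases block (L.take n) (fun z hz => hL z (List.mem_of_mem_take hz)) (by simp; omega) with h | h
    · simp [h]
    rcases block (L.drop (n + 1)) (fun z hz => hL z (List.mem_of_mem_drop hz))
      (by simp; omega) with h' | h'
    · simp [h']
    exact mul_sub_mul_eq_zero hB hFB (hL _ (List.getElem_mem hlt)) h h'

/-- The additive group generated by the products `(p - q) * t`, where `(p, q)` runs through `F`
and `t` centralizes the band `B`. -/
def diffIdeal (B : Submonoid R) (F : Set (R × R)) : AddSubgroup R :=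
  AddSubgroup.closure
    {x | ∃ z ∈ F, ∃ t ∈ Set.centralizer (B : Set R), x = (z.1 - z.2) * t}

theorem diffIdeal_mono {F F' : Set (R × R)} (h : F ⊆ F') : diffIdeal B F ≤ diffIdeal B F' := by
  refine AddSubgroup.closure_mono ?_
  rintro x ⟨z, hz, t, ht, rfl⟩
  exact ⟨z, h hz, t, ht, rfl⟩

theorem exists_finset_mem_diffIdeal {F : Set (R × R)} {x : R} (hx : x ∈ diffIdeal B F) :
    ∃ G : Finset (R × R), (G : Set (R × R)) ⊆ F ∧ x ∈ diffIdeal B (G : Set (R × R)) := by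
  classical
  induction hx using AddSubgroup.closure_induction with
  | mem x hx =>
    obtain ⟨z, hz, t, ht, rfl⟩ := hx
    exact ⟨{z}, by simpa using hz, AddSubgroup.subset_closure ⟨z, by simp, t, ht, rfl⟩⟩
  | zero => exact ⟨∅, by simp, zero_mem _⟩
  | add x y _ _ hx hy =>
    obtain ⟨G, hG, hx⟩ := hx
    obtain ⟨G', hG', hy⟩ := hy
    refine ⟨G ∪ G', by simp [hG, hG'], add_mem (diffIdeal_mono ?_ hx) (diffIdeal_mono ?_ hy)⟩
    · simp
    · simp
  | neg x _ hx =>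
    obtain ⟨G, hG, hx⟩ := hx
    exact ⟨G, hG, neg_mem hx⟩

theorem pow_mem_closure_diffProd {F : Set (R × R)} (hF : F ⊆ equivPairs B) {x : R}
    (hx : x ∈ diffIdeal B F) (n : ℕ) :
    x ^ n ∈ AddSubgroup.closure {y | ∃ L : List (R × R), (∀ z ∈ L, z ∈ F) ∧ L.length = n ∧
      ∃ t ∈ Set.centralizer (B : Set R), y = diffProd L * t} := by
  induction n with
  | zero =>
    exact AddSubgroup.subset_closure
      ⟨[], by simp, rfl, 1, Set.one_mem_centralizer, by simp [diffProd]⟩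
  | succ n ih =>
    rw [pow_succ]
    generalize x ^ n = y at ih
    induction ih using AddSubgroup.closure_induction with
    | mem y hy =>
      induction hx using AddSubgroup.closure_induction with
      | mem x hx =>
        obtain ⟨L, hL, hn, t, ht, rfl⟩ := hy
        obtain ⟨z, hz, s, hs, rfl⟩ := hx
        refine AddSubgroup.subset_closure
          ⟨L ++ [z], ?_, by simp [hn], t * s, Set.mul_mem_centralizer ht hs, ?_⟩
        · intro y hy
          rcases List.mem_append.1 hy with hy | hy
          · exact hL y hy
          · rw [List.mem_singleton.1 hy]; exact hz
        · have hcomm : t * (z.1 - z.2) = (z.1 - z.2) * t := by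
            rw [mul_sub, sub_mul, ht _ (hF hz).1, ht _ (hF hz).2.1]
          rw [diffProd_append]
          simp only [diffProd, List.map_cons, List.map_nil, List.prod_singleton]
          rw [mul_assoc, ← mul_assoc t, hcomm]
          simp only [mul_assoc]
      | zero => simp
      | add a b _ _ ha hb => rw [mul_add]; exact add_mem ha hb
      | neg a _ ha => rw [mul_neg]; exact neg_mem ha
    | zero => simp
    | add a b _ _ ha hb => rw [add_mul]; exact add_mem ha hb
    | neg a _ ha => rw [neg_mul]; exact neg_mem ha

theorem isNilpotent_of_mem_diffIdeal (hB : ∀ b ∈ B, b * b = b) {x : R}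
    (hx : x ∈ diffIdeal B (equivPairs B)) : IsNilpotent x := by
  obtain ⟨G, hG, hx⟩ := exists_finset_mem_diffIdeal hx
  obtain ⟨n, hn⟩ := exists_diffProd_eq_zero hB G.card
  refine ⟨n, ?_⟩
  have h := pow_mem_closure_diffProd hG hx n
  refine (AddSubgroup.closure_le (K := (⊥ : AddSubgroup R))).2 ?_ h
  rintro y ⟨L, hL, hlen, t, -, rfl⟩
  simp [hn G le_rfl hG L hL hlen.ge]

theorem mul_left_mem_diffIdeal (hB : ∀ b ∈ B, b * b = b) {h x : R}
    (hh : h ∈ (B : Set R) ∪ Set.centralizer (B : Set R)) (hx : x ∈ diffIdeal B (equivPairs B)) :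
    h * x ∈ diffIdeal B (equivPairs B) := by
  induction hx using AddSubgroup.closure_induction with
  | mem x hx =>
    obtain ⟨z, hz, t, ht, rfl⟩ := hx
    refine AddSubgroup.subset_closure ?_
    rcases hh with hh | hh
    · exact ⟨_, mul_left_mem_equivPairs hB hz hh, t, ht, by simp only [mul_sub, mul_assoc, sub_mul]⟩
    · refine ⟨z, hz, h * t, Set.mul_mem_centralizer hh ht, ?_⟩
      have hcomm : h * (z.1 - z.2) = (z.1 - z.2) * h := by
        rw [mul_sub, sub_mul, hh _ hz.1, hh _ hz.2.1]
      rw [← mul_assoc, hcomm, mul_assoc]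
  | zero => simp
  | add a b _ _ ha hb => rw [mul_add]; exact add_mem ha hb
  | neg a _ ha => rw [mul_neg]; exact neg_mem ha

theorem mul_right_mem_diffIdeal (hB : ∀ b ∈ B, b * b = b) {h x : R}
    (hh : h ∈ (B : Set R) ∪ Set.centralizer (B : Set R)) (hx : x ∈ diffIdeal B (equivPairs B)) :
    x * h ∈ diffIdeal B (equivPairs B) := by
  induction hx using AddSubgroup.closure_induction with
  | mem x hx =>
    obtain ⟨z, hz, t, ht, rfl⟩ := hx
    refine AddSubgroup.subset_closure ?_
    rcases hh with hh | hh
    · refine ⟨_, mul_right_mem_equivPairs hB hz hh, t, ht, ?_⟩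
      rw [mul_assoc, ← ht h hh, ← mul_assoc, sub_mul]
    · exact ⟨z, hz, t * h, Set.mul_mem_centralizer ht hh, mul_assoc _ _ _⟩
  | zero => simp
  | add a b _ _ ha hb => rw [add_mul]; exact add_mem ha hb
  | neg a _ ha => rw [neg_mul]; exact neg_mem ha

end Ring

/-! ### Spans of commuting idempotents -/

section Algebra

variable {k R : Type*} [Field k] [Ring R] [Algebra k R]

/-- The scalar `r` and the idempotent `f` make the induction on `G` go through: `1 = e + (1 - e)`
splits off the summand of `e`, which becomes a scalar on `f * e` and disappears on
`f * (1 - e)`. -/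
theorem mul_eq_zero_of_isNilpotent_of_commute (G : Finset R) (c : R → k)
    (hG : ∀ e ∈ G, e * e = e) (hcomm : ∀ e ∈ G, ∀ e' ∈ G, e * e' = e' * e) (r : k) (f : R)
    (hf : f * f = f) (hfG : ∀ e ∈ G, e * f = f * e)
    (hnil : IsNilpotent ((algebraMap k R r + ∑ e ∈ G, c e • e) * f)) :
    (algebraMap k R r + ∑ e ∈ G, c e • e) * f = 0 := by
  classical
  induction G using Finset.induction_on generalizing r f with
  | empty =>
    obtain ⟨n, hn⟩ := hnil
    simp only [Finset.sum_empty, add_zero, ← Algebra.smul_def] at hn ⊢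
    by_cases hr : r = 0
    · simp [hr]
    rw [smul_pow] at hn
    have h0 : f ^ n = 0 := (smul_eq_zero_iff_right (pow_ne_zero n hr)).1 hn
    have h1 : f ^ (n + 1) = f := IsIdempotentElem.pow_succ_eq n hf
    rw [pow_succ, h0, zero_mul] at h1
    simp [← h1]
  | insert e G he ih =>
    simp only [Finset.mem_insert, forall_eq_or_imp] at hG hcomm hfG
    obtain ⟨hee, hG⟩ := hG
    obtain ⟨⟨-, heG⟩, hGG⟩ := hcomm
    obtain ⟨hef, hfG⟩ := hfG
    rw [Finset.sum_insert he] at hnil ⊢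
    set y := ∑ e ∈ G, c e • e with hy
    set x := algebraMap k R r + (c e • e + y) with hx
    have hey : Commute e y := Commute.sum_right _ _ _ fun i hi => Commute.smul_right (heG i hi) _
    have hex : Commute e (x * f) := by
      refine Commute.mul_right (Commute.add_right ?_ (Commute.add_right ?_ hey)) hef
      · exact (Algebra.commutes r e).symm
      · exact (Commute.refl e).smul_right _
    have h1e : Commute (1 - e) (x * f) := (Commute.one_left _).sub_left hex
    have e1 : (algebraMap k R (r + c e) + y) * (f * e) = x * f * e := by
      have : (algebraMap k R (c e)) * (f * e) = (c e • e) * (f * e) := by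
        rw [Algebra.smul_def, mul_assoc, ← mul_assoc e f e, hef, mul_assoc f e e, hee]
      rw [hx, map_add, add_assoc, add_mul, add_mul, this]
      simp only [add_mul, mul_assoc]
    have e2 : (algebraMap k R r + y) * (f * (1 - e)) = x * f * (1 - e) := by
      have : (c e • e) * (f * (1 - e)) = 0 := by
        rw [smul_mul_assoc, ← mul_assoc, hef, mul_assoc, mul_sub, mul_one, hee, sub_self,
          mul_zero, smul_zero]
      rw [mul_assoc x, hx, add_mul, add_mul, add_mul, this, zero_add]
    have z1 : x * f * e = 0 := by
      rw [← e1]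
      refine ih hG (fun a ha => (hGG a ha).2) (r + c e) (f * e) ?_ (fun a ha => ?_) ?_
      · rw [mul_assoc, ← mul_assoc e, hef, mul_assoc f e e, hee, ← mul_assoc, hf]
      · rw [← mul_assoc, hfG a ha, mul_assoc, ← heG a ha, mul_assoc]
      · rw [e1]; exact hex.symm.isNilpotent_mul_right hnil
    have z2 : x * f * (1 - e) = 0 := by
      rw [← e2]
      have hfe : Commute f (1 - e) := (Commute.one_right f).sub_right hef.symm
      refine ih hG (fun a ha => (hGG a ha).2) r (f * (1 - e)) ?_ (fun a ha => ?_) ?_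
      · have : (1 - e) * (1 - e) = 1 - e := IsIdempotentElem.one_sub hee
        rw [mul_assoc, ← mul_assoc (1 - e), ← hfe.eq, mul_assoc f (1 - e), this, ← mul_assoc, hf]
      · have : Commute a (f * (1 - e)) :=
          Commute.mul_right (hfG a ha) ((Commute.one_right a).sub_right (heG a ha).symm)
        exact this
      · rw [e2]; exact h1e.symm.isNilpotent_mul_right hnil
    calc x * f = x * f * e + x * f * (1 - e) := by rw [← mul_add]; simp
      _ = 0 := by rw [z1, z2, add_zero]

theorem eq_zero_of_isNilpotent_of_mem_span {E : Set R} (hE : ∀ e ∈ E, e * e = e)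
    (hcomm : ∀ e ∈ E, ∀ e' ∈ E, e * e' = e' * e) {x : R} (hx : x ∈ Submodule.span k E)
    (hnil : IsNilpotent x) : x = 0 := by
  obtain ⟨c, G, hG, -, rfl⟩ := Submodule.mem_span_iff_exists_finset_subset.1 hx
  have h := mul_eq_zero_of_isNilpotent_of_commute G c (fun e he => hE e (hG he))
    (fun e he e' he' => hcomm e (hG he) e' (hG he')) 0 1 (one_mul 1) (by simp)
  simpa using h (by simpa using hnil)

end Algebra

/-! ### The ideal of the hyperalgebra -/

section Operators

variable {X : Type*} [NormedAddCommGroup X] [NormedSpace ℂ X] {S : Set (X →L[ℂ] X)}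

/-- The band obtained from `S` by adjoining the identity operator. -/
def IsOperatorBand.submonoid (hS : IsOperatorBand S) : Submonoid (X →L[ℂ] X) where
  carrier := insert 1 S
  one_mem' := Set.mem_insert _ _
  mul_mem' := by
    rintro a b (rfl | ha) (rfl | hb)
    · simp
    · simp [hb]
    · simp [ha]
    · exact Or.inr (hS.mul_mem ha hb)

theorem IsOperatorBand.mul_self_of_mem_submonoid (hS : IsOperatorBand S) :
    ∀ b ∈ hS.submonoid, b * b = b := by
  rintro b (rfl | hb)
  · simp
  · exact hS.idempotent hb

theorem IsOperatorBand.centralizer_submonoid (hS : IsOperatorBand S) :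
    Set.centralizer (hS.submonoid : Set (X →L[ℂ] X)) = commutant S := by
  ext T
  constructor
  · exact fun h A hA => (h A (Or.inr hA)).symm
  · rintro h A (rfl | hA)
    · simp
    · exact (h A hA).symm

theorem IsOperatorBand.mem_span_submonoid (hS : IsOperatorBand S) {T : X →L[ℂ] X}
    (hT : T ∈ generatedAlgebra S) :
    T ∈ Submodule.span ℂ (hS.submonoid : Set (X →L[ℂ] X)) := by
  have h : generatedAlgebra S ≤
      (Algebra.adjoin ℂ (hS.submonoid : Set (X →L[ℂ] X))).toNonUnitalSubalgebra :=
    NonUnitalAlgebra.adjoin_le fun A hA => Algebra.subset_adjoin (Or.inr hA)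
  have h' : T ∈ Subalgebra.toSubmodule (Algebra.adjoin ℂ (hS.submonoid : Set (X →L[ℂ] X))) := h hT
  rwa [Algebra.adjoin_eq_span, Submonoid.closure_eq] at h'

theorem IsOperatorBand.submonoid_subset_hyperalgebra (hS : IsOperatorBand S) :
    (hS.submonoid : Set (X →L[ℂ] X)) ⊆ hyperalgebra S := by
  rintro A (rfl | hA)
  · exact one_mem _
  · exact Algebra.subset_adjoin (Or.inl hA)

theorem IsOperatorBand.mul_mem_diffIdeal (hS : IsOperatorBand S) {T : X →L[ℂ] X}
    (hT : T ∈ hyperalgebra S) :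
    ∀ x ∈ diffIdeal hS.submonoid (equivPairs hS.submonoid),
      T * x ∈ diffIdeal hS.submonoid (equivPairs hS.submonoid) ∧
        x * T ∈ diffIdeal hS.submonoid (equivPairs hS.submonoid) := by
  have hB := hS.mul_self_of_mem_submonoid
  induction hT using Algebra.adjoin_induction with
  | mem T hT =>
    have hT' : T ∈ (hS.submonoid : Set (X →L[ℂ] X)) ∪
        Set.centralizer (hS.submonoid : Set (X →L[ℂ] X)) := by
      rw [hS.centralizer_submonoid]
      exact hT.imp_left Or.inr
    exact fun x hx => ⟨mul_left_mem_diffIdeal hB hT' hx, mul_right_mem_diffIdeal hB hT' hx⟩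
  | algebraMap r =>
    have hr : algebraMap ℂ (X →L[ℂ] X) r ∈ (hS.submonoid : Set (X →L[ℂ] X)) ∪
        Set.centralizer (hS.submonoid : Set (X →L[ℂ] X)) :=
      Or.inr fun A _ => (Algebra.commutes r A).symm
    exact fun x hx => ⟨mul_left_mem_diffIdeal hB hr hx, mul_right_mem_diffIdeal hB hr hx⟩
  | add a b _ _ ha hb =>
    intro x hx
    rw [add_mul, mul_add]
    exact ⟨add_mem (ha x hx).1 (hb x hx).1, add_mem (ha x hx).2 (hb x hx).2⟩
  | mul a b _ _ ha hb =>
    intro x hx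
    rw [mul_assoc, ← mul_assoc x]
    exact ⟨(ha _ (hb x hx).1).1, (hb _ (ha x hx).2).2⟩

/-- `diffIdeal`, for all pairs of equivalent elements of the band, as an ideal of the
hyperalgebra. -/
def IsOperatorBand.diffHyperIdeal (hS : IsOperatorBand S) : TwoSidedIdeal (hyperalgebra S) :=
  TwoSidedIdeal.mk'
    {T | (T : X →L[ℂ] X) ∈ diffIdeal hS.submonoid (equivPairs hS.submonoid)}
    (zero_mem (diffIdeal hS.submonoid (equivPairs hS.submonoid)))
    (fun hx hy =>
      AddSubgroup.add_mem (diffIdeal hS.submonoid (equivPairs hS.submonoid)) hx hy)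
    (fun hx => AddSubgroup.neg_mem (diffIdeal hS.submonoid (equivPairs hS.submonoid)) hx)
    (fun {x y} hy => (hS.mul_mem_diffIdeal x.2 y hy).1)
    (fun {x y} hx => (hS.mul_mem_diffIdeal y.2 x hx).2)

theorem IsOperatorBand.mem_diffHyperIdeal (hS : IsOperatorBand S) {T : hyperalgebra S} :
    T ∈ hS.diffHyperIdeal ↔
      (T : X →L[ℂ] X) ∈ diffIdeal hS.submonoid (equivPairs hS.submonoid) := by
  unfold IsOperatorBand.diffHyperIdeal
  rw [TwoSidedIdeal.mem_mk']
  rfl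

/-- Modulo `diffHyperIdeal` the band is commutative, so no nilpotent of its span survives. -/
theorem IsOperatorBand.mem_diffHyperIdeal_of_mem_nilpotents (hS : IsOperatorBand S)
    {T : hyperalgebra S} (hT : (T : X →L[ℂ] X) ∈ nilpotents S) : T ∈ hS.diffHyperIdeal := by
  have hB := hS.mul_self_of_mem_submonoid
  let π : hyperalgebra S →ₐ[ℂ] hS.diffHyperIdeal.ringCon.Quotient :=
    { hS.diffHyperIdeal.ringCon.mk' with commutes' := fun _ => rfl }
  have hπ : ∀ T, π T = 0 ↔ T ∈ hS.diffHyperIdeal := fun T => by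
    rw [TwoSidedIdeal.mem_iff]
    exact RingCon.eq _
  let E : Set (hyperalgebra S) := {A | (A : X →L[ℂ] X) ∈ hS.submonoid}
  have hTE : T ∈ Submodule.span ℂ E := by
    have himage : (hyperalgebra S).val.toLinearMap '' E = hS.submonoid := by
      ext A
      constructor
      · rintro ⟨A, hA, rfl⟩
        exact hA
      · exact fun hA => ⟨⟨A, hS.submonoid_subset_hyperalgebra hA⟩, hA, rfl⟩
    have h := hS.mem_span_submonoid hT.1
    rw [← himage, ← Submodule.map_span] at h
    obtain ⟨T', hT', heq⟩ := h
    rwa [← Subtype.ext (a1 := T') (a2 := T) heq]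
  have hnil : IsNilpotent T := by
    obtain ⟨n, hn⟩ := hT.2
    exact ⟨n, Subtype.ext (by simpa using hn)⟩
  rw [← hπ]
  refine eq_zero_of_isNilpotent_of_mem_span (k := ℂ) (E := π '' E) ?_ ?_ ?_ (hnil.map π)
  · rintro _ ⟨A, hA, rfl⟩
    rw [← map_mul]
    exact congrArg π (Subtype.ext (hB _ hA))
  · rintro _ ⟨A, hA, rfl⟩ _ ⟨A', hA', rfl⟩
    rw [← sub_eq_zero, ← map_mul, ← map_mul, ← map_sub, hπ, hS.mem_diffHyperIdeal]
    exact AddSubgroup.subset_closure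
      ⟨_, mul_comm_mem_equivPairs hB hA hA', 1, Set.one_mem_centralizer, by simp⟩
  · have h := Submodule.mem_map_of_mem (f := π.toLinearMap) hTE
    rwa [Submodule.map_span] at h

end Operators

end OperatorBand

theorem proposition4p1 {X : Type*} [NormedAddCommGroup X] [NormedSpace ℂ X] [CompleteSpace X]
    (S : Set (X →L[ℂ] X)) (hS : OperatorBand.IsOperatorBand S) (hS0 : S ≠ {0})
    (N : Set (X →L[ℂ] X)) (hN : N.Nonempty) (hNS : N ⊆ OperatorBand.nilpotents S) :
    OperatorBand.IsNilIdeal (OperatorBand.hyperIdeal S N) := by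
  have hle : OperatorBand.hyperIdeal S N ≤ hS.diffHyperIdeal :=
    TwoSidedIdeal.span_le.2 fun T hT => hS.mem_diffHyperIdeal_of_mem_nilpotents (hNS hT)
  intro T hT
  obtain ⟨n, hn⟩ := OperatorBand.isNilpotent_of_mem_diffIdeal hS.mul_self_of_mem_submonoid
    (hS.mem_diffHyperIdeal.1 (hle hT))
  exact ⟨n, Subtype.ext (by simpa using hn)⟩
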